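/- Let $S$ be the Thue–Morse substitution $S(0)=01$, $S(1)=10$ on the alphabet $\{0,1\}$, let $u=01101001\ldots$ be the one-sided sequence obtained by iterating $S$ on $0$, and let $\Omega_{\rm tm}$ be the set of all two-sided sequences $\omega\in\{0,1\}^{\mathbb Z}$ all of whose finite subwords occur in $u$. For $\lambda\in\mathbb R$ and $\omega\in\Omega_{\rm tm}$ let $H=H_{\lambda,\omega}$ be the operator on $\ell^2(\mathbb Z)$ given by $$(H\psi)(n)=\psi(n-1)+\psi(n+1)+\lambda\,\omega_n\,\psi(n).$$ For $p>0$ and $T>0$ put $$a(n,T)=\frac1T\int_0^\infty e^{-2t/T}\,\bigl|\langle \delta_n, e^{-itH}\delta_1\rangle\bigr|^2\,dt,\qquad \langle |X|^p\rangle(T)=\sum_{n\in\mathbb Z}|n|^p\,a(n,T),$$ $$\beta^-(p)=\liminf_{T\to+\infty}\frac{\log\,\langle |X|^p\rangle(T)}{\log T}.$$ Then for every $\lambda\in\mathbb R$, every $\omega\in\Omega_{\rm tm}$ and every $p>0$, $$\beta^-(p)\ge p-1.$$ -/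

import Mathlib

open scoped ENNReal

noncomputable section

namespace ThueMorse

/-! ## The Thue–Morse sequence and subshift -/

/-- The Thue–Morse substitution on letters: `0 ↦ 01`, `1 ↦ 10`. -/
def substLetter (a : Fin 2) : List (Fin 2) :=
  if a = 0 then [0, 1] else [1, 0]

/-- The Thue–Morse substitution, extended to finite words by concatenation. -/
def substWord (w : List (Fin 2)) : List (Fin 2) :=
  w.flatMap substLetter

/-- The word `S^k(0)`. -/
def word (k : ℕ) : List (Fin 2) :=
  substWord^[k] [0]

/-- The one-sided Thue–Morse sequence `u = 01101001…` obtained by iterating the substitution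
on `0`. The word `S^n(0)` has length `2 ^ n > n` and each `S^k(0)` is a prefix of `S^(k+1)(0)`,
so the letter of `u` at position `n` can be read off from `S^n(0)`
(see `word_getElem_eq_u`; the default value of `getD` is never used). -/
def u (n : ℕ) : Fin 2 :=
  (word n).getD n 0

lemma length_substWord (w : List (Fin 2)) : (substWord w).length = 2 * w.length := by
  induction w with
  | nil => rfl
  | cons a w ih =>
    have h : (substLetter a).length = 2 := by
      unfold substLetter; split_ifs <;> rfl
    simp only [substWord, List.flatMap_cons, List.length_append, List.length_cons] at ih ⊢
    omega

lemma word_succ (k : ℕ) : word (k + 1) = substWord (word k) :=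
  Function.iterate_succ_apply' _ _ _

lemma length_word (k : ℕ) : (word k).length = 2 ^ k := by
  induction k with
  | zero => rfl
  | succ k ih => rw [word_succ, length_substWord, ih, pow_succ, mul_comm]

lemma word_prefix_succ (k : ℕ) : word k <+: word (k + 1) := by
  induction k with
  | zero => exact ⟨[1], rfl⟩
  | succ k ih =>
    obtain ⟨t, ht⟩ := ih
    refine ⟨substWord t, ?_⟩
    rw [word_succ (k + 1), word_succ k, ← word_succ k, ← ht]
    conv_lhs => rw [ht, word_succ k]
    simp [substWord, List.flatMap_append]

lemma word_prefix {k l : ℕ} (h : k ≤ l) : word k <+: word l := by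
  induction l, h using Nat.le_induction with
  | base => exact List.prefix_refl _
  | succ l _ ih => exact ih.trans (word_prefix_succ l)

/-- Every word `S^k(0)` is the prefix of length `2 ^ k` of the sequence `u`. -/
lemma word_getElem_eq_u (k n : ℕ) (h : n < (word k).length) : (word k)[n] = u n := by
  have hn : n < (word n).length := by rw [length_word]; exact Nat.lt_two_pow_self
  have e : u n = (word n)[n] := by simp [u, hn]
  rw [e]
  rcases le_total k n with hkn | hkn
  · exact (word_prefix hkn).getElem h
  · exact ((word_prefix hkn).getElem hn).symm

/-- The two-sided Thue–Morse subshift: all two-sided sequences over `{0, 1}` all of whose finite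
subwords `ω_m ω_{m+1} … ω_{m+l-1}` occur in `u`. -/
def subshift : Set (ℤ → Fin 2) :=
  {ω | ∀ (m : ℤ) (l : ℕ), ∃ j : ℕ, ∀ i : ℕ, i < l → ω (m + i) = u (j + i)}

/-- The potential `V(n) = lam * ω_n`, with `ω_n ∈ {0, 1}`. -/
def potential (lam : ℝ) (ω : ℤ → Fin 2) (n : ℤ) : ℝ :=
  lam * ((ω n : ℕ) : ℝ)

lemma bddAbove_potential (lam : ℝ) (ω : ℤ → Fin 2) :
    BddAbove (Set.range fun n => |potential lam ω n|) := by
  refine ⟨|lam|, ?_⟩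
  rintro _ ⟨n, rfl⟩
  have h1 : (((ω n : Fin 2) : ℕ) : ℝ) ≤ 1 := by
    have := (ω n).isLt
    exact_mod_cast Nat.le_of_lt_succ this
  have h0 : (0 : ℝ) ≤ (((ω n : Fin 2) : ℕ) : ℝ) := Nat.cast_nonneg _
  simp only [potential, abs_mul, abs_of_nonneg h0]
  exact mul_le_of_le_one_right (abs_nonneg _) h1

end ThueMorse

namespace DiscreteSchrodinger

/-! ## Discrete Schrödinger operators on `ℓ²(ℤ)` -/

/-- The Hilbert space `ℓ²(ℤ)` of square-summable functions `ℤ → ℂ`. -/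
abbrev H2 : Type := lp (fun _ : ℤ => ℂ) 2

/-- The basis vector `δ_m`. -/
def delta (m : ℤ) : H2 := lp.single 2 m (1 : ℂ)

lemma memlp_shift (k : ℤ) (ψ : H2) : Memℓp (fun n : ℤ => (ψ (n + k) : ℂ)) 2 := by
  have hp : (0 : ℝ) < (2 : ℝ≥0∞).toReal := by norm_num
  have h := (memℓp_gen_iff hp).1 (lp.memℓp ψ)
  exact (memℓp_gen_iff hp).2 (h.comp_injective (add_left_injective k))

/-- The translation `(ψ(n))_n ↦ (ψ(n + k))_n` on `ℓ²(ℤ)`. -/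
def shift (k : ℤ) : H2 →L[ℂ] H2 :=
  LinearMap.mkContinuous
    { toFun := fun ψ => ⟨fun n : ℤ => ψ (n + k), memlp_shift k ψ⟩
      map_add' := fun _ _ => rfl
      map_smul' := fun _ _ => rfl } 1 (by
    intro ψ
    have hp : (0 : ℝ) < (2 : ℝ≥0∞).toReal := by norm_num
    rw [one_mul, lp.norm_eq_tsum_rpow hp, lp.norm_eq_tsum_rpow hp ψ]
    refine le_of_eq ?_
    congr 1
    exact (Equiv.addRight k).tsum_eq (fun n : ℤ => ‖(ψ n : ℂ)‖ ^ (2 : ℝ≥0∞).toReal))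

lemma norm_mul_le {V : ℤ → ℝ} {C : ℝ} (hC : ∀ n, |V n| ≤ C) (ψ : H2) (n : ℤ) :
    ‖(V n : ℂ) * ψ n‖ ≤ ‖((C : ℂ) • ψ : H2) n‖ := by
  have hC0 : 0 ≤ C := (abs_nonneg _).trans (hC 0)
  rw [lp.coeFn_smul, Pi.smul_apply, smul_eq_mul, norm_mul, norm_mul, Complex.norm_real,
    Complex.norm_real, Real.norm_eq_abs, Real.norm_eq_abs, abs_of_nonneg hC0]
  exact mul_le_mul_of_nonneg_right (hC n) (norm_nonneg _)

lemma memlp_mul {V : ℤ → ℝ} (hV : BddAbove (Set.range fun n => |V n|)) (ψ : H2) :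
    Memℓp (fun n : ℤ => (V n : ℂ) * ψ n) 2 := by
  obtain ⟨C, hC⟩ := hV
  have hp : (0 : ℝ) < (2 : ℝ≥0∞).toReal := by norm_num
  have hC' : ∀ n, |V n| ≤ C := fun n => hC ⟨n, rfl⟩
  have h := (memℓp_gen_iff hp).1 (lp.memℓp ((C : ℂ) • ψ : H2))
  refine (memℓp_gen_iff hp).2 (h.of_nonneg_of_le (fun n => by positivity) fun n => ?_)
  exact Real.rpow_le_rpow (norm_nonneg _) (norm_mul_le hC' ψ n) hp.le

/-- Multiplication by a bounded real potential `V` on `ℓ²(ℤ)`. -/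
def mulPotential (V : ℤ → ℝ) (hV : BddAbove (Set.range fun n => |V n|)) : H2 →L[ℂ] H2 :=
  LinearMap.mkContinuousOfExistsBound
    { toFun := fun ψ => ⟨fun n : ℤ => (V n : ℂ) * ψ n, memlp_mul hV ψ⟩
      map_add' := fun ψ φ => by
        ext n
        exact mul_add _ _ _
      map_smul' := fun c ψ => by
        ext n
        exact mul_left_comm _ _ _ } (by
    obtain ⟨C, hC⟩ := id hV
    have hC' : ∀ n, |V n| ≤ C := fun n => hC ⟨n, rfl⟩
    refine ⟨C, fun ψ => ?_⟩
    have hC0 : 0 ≤ C := (abs_nonneg _).trans (hC' 0)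
    have h := lp.norm_mono (p := 2) (by norm_num)
      (x := (⟨fun n : ℤ => (V n : ℂ) * ψ n, memlp_mul hV ψ⟩ : H2))
      (y := ((C : ℂ) • ψ : H2)) (norm_mul_le hC' ψ)
    rwa [norm_smul, Complex.norm_real, Real.norm_eq_abs, abs_of_nonneg hC0] at h)

/-- The discrete Schrödinger operator `(Hψ)(n) = ψ(n-1) + ψ(n+1) + V(n)ψ(n)` on `ℓ²(ℤ)` with a
bounded real potential `V`. -/
def hamiltonian (V : ℤ → ℝ) (hV : BddAbove (Set.range fun n => |V n|)) : H2 →L[ℂ] H2 :=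
  shift (-1) + shift 1 + mulPotential V hV

lemma hamiltonian_apply (V : ℤ → ℝ) (hV : BddAbove (Set.range fun n => |V n|)) (ψ : H2) (n : ℤ) :
    hamiltonian V hV ψ n = ψ (n - 1) + ψ (n + 1) + (V n : ℂ) * ψ n :=
  rfl

/-- The time evolution `exp(-itH) ψ`. -/
def evolve (H : H2 →L[ℂ] H2) (t : ℝ) (ψ : H2) : H2 :=
  NormedSpace.exp ((-(Complex.I * (t : ℂ))) • H) ψ

/-- The time-averaged probability
`a(n,T) = (1/T) ∫_0^∞ e^{-2t/T} |(e^{-itH} δ_1)(n)|² dt`, as an extended nonnegative number. -/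
def timeAvgProb (H : H2 →L[ℂ] H2) (n : ℤ) (T : ℝ) : ℝ≥0∞ :=
  ENNReal.ofReal (1 / T) *
    ∫⁻ t in Set.Ioi (0 : ℝ),
      ENNReal.ofReal (Real.exp (-2 * t / T) * ‖evolve H t (delta 1) n‖ ^ 2)

/-- The time-averaged `p`-th moment `∑_n |n|^p a(n,T)` of the position operator for the initial
state `δ_1`. -/
def moment (H : H2 →L[ℂ] H2) (p T : ℝ) : ℝ≥0∞ :=
  ∑' n : ℤ, ENNReal.ofReal (|(n : ℝ)| ^ p) * timeAvgProb H n T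

/-- The lower growth exponent
`β⁻(p) = liminf_{T → ∞} log (∑_n |n|^p a(n,T)) / log T`, as an extended real number. -/
def betaMinus (H : H2 →L[ℂ] H2) (p : ℝ) : EReal :=
  Filter.liminf (fun T : ℝ => ENNReal.log (moment H p T) / ((Real.log T : ℝ) : EReal))
    Filter.atTop

end DiscreteSchrodinger

end

/-! ### Transfer over blocks of the Thue–Morse sequence -/

namespace ThueMorse

/-! One energy suffices. Choose a real `E` with `E * (E - lam) = 2`. The transfer matrices over the
words `01` and `10` then have determinant `1` and trace `E * (E - lam) - 2 = 0`, so both square to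
`-1`. Since `S³(0) = 01·10·10·01` and `S³(1) = 10·01·01·10`, the transfer matrix over every aligned
block of length `8` of `u` is the identity (`recursion_block_eq`). Hence all solutions at energy `E`
are bounded by their data, with a constant independent of the window (`recursion_bounded`), and this
passes to every `ω` in the subshift.

Boundedness at `E` survives a perturbation to `z = E + 2i/T` over distances up to `T`: by a
Wronskian identity and a discrete Gronwall argument, a solution at `z` can shrink only by a constant
factor there (`BoundedSolutions.norm_le`). The Green function `G = ⟨δ_n, (H - z)⁻¹ δ_1⟩` solves the
equation at `z` on either side of site `1`, and the source term prevents it from being small near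
`1` on both sides. So on one side `|G(n)|² + |G(n+1)|²` is bounded below for `1 ≤ n ≤ T`, with `n`
counting outwards.

`G` is a Laplace transform of the evolution, so Cauchy–Schwarz gives `a(n,T) ≥ (2/T²) |G(n)|²`
(`sq_norm_green_le`); no integration over energies is needed. Summing over order `T` sites at
distance of order `T` yields a moment of at least a constant times `T · T^p · T⁻² = T^(p-1)`. -/

lemma getElem?_substWord (w : List (Fin 2)) (i : ℕ) :
    (substWord w)[2 * i]? = w[i]? ∧ (substWord w)[2 * i + 1]? = w[i]?.map (1 - ·) := by
  induction w generalizing i with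
  | nil => simp [substWord]
  | cons a w ih =>
    have hs : substWord (a :: w) = a :: (1 - a) :: substWord w := by
      have : substLetter a = [a, 1 - a] := by revert a; decide
      simp [substWord, this]
    rw [hs]
    cases i with
    | zero => simp
    | succ i =>
      have := ih i
      rw [show 2 * (i + 1) = 2 * i + 1 + 1 by ring]
      simpa using this

lemma u_double (n : ℕ) : u (2 * n) = u n ∧ u (2 * n + 1) = 1 - u n := by
  have hn : n < (word n).length := by rw [length_word]; exact Nat.lt_two_pow_self
  have h1 : 2 * n + 1 < (word (n + 1)).length := by
    rw [length_word, pow_succ]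
    have := Nat.lt_two_pow_self (n := n)
    omega
  have h := getElem?_substWord (word n) n
  rw [← word_succ, List.getElem?_eq_getElem hn, List.getElem?_eq_getElem h1,
    List.getElem?_eq_getElem (by omega), word_getElem_eq_u, word_getElem_eq_u,
    word_getElem_eq_u] at h
  simpa using h

/-- The letters of `u` in a block of length `8` are those of the third iterate `S³(u k)`. -/
lemma u_block (k : ℕ) :
    u (8 * k) = u k ∧ u (8 * k + 1) = 1 - u k ∧ u (8 * k + 2) = 1 - u k ∧ u (8 * k + 3) = u k ∧
    u (8 * k + 4) = 1 - u k ∧ u (8 * k + 5) = u k ∧ u (8 * k + 6) = u k ∧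
    u (8 * k + 7) = 1 - u k := by
  have a := u_double k
  have b := u_double (2 * k)
  have c := u_double (2 * k + 1)
  have d0 := u_double (2 * (2 * k))
  have d1 := u_double (2 * (2 * k) + 1)
  have d2 := u_double (2 * (2 * k + 1))
  have d3 := u_double (2 * (2 * k + 1) + 1)
  ring_nf at a b c d0 d1 d2 d3 ⊢
  generalize u k = e at *
  simp only [a, b, c] at d0 d1 d2 d3
  simp only [d0, d1, d2, d3]
  clear a b c d0 d1 d2 d3
  revert e
  decide

/-- If the two letters carry coefficients with product `2`, then the second-order recursion along
`u` is the identity over every block of length `8`. -/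
lemma recursion_block_eq {q : Fin 2 → ℂ} (hq : q 0 * q 1 = 2) {g : ℕ → ℂ} {k : ℕ}
    (h : ∀ x, 8 * k ≤ x → x < 8 * k + 8 → g (x + 2) = q (u x) * g (x + 1) - g x) :
    g (8 * k + 8) = g (8 * k) ∧ g (8 * k + 9) = g (8 * k + 1) := by
  obtain ⟨u0, u1, u2, u3, u4, u5, u6, u7⟩ := u_block k
  have h0 := h (8 * k) (by omega) (by omega)
  have h1 := h (8 * k + 1) (by omega) (by omega)
  have h2 := h (8 * k + 2) (by omega) (by omega)
  have h3 := h (8 * k + 3) (by omega) (by omega)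
  have h4 := h (8 * k + 4) (by omega) (by omega)
  have h5 := h (8 * k + 5) (by omega) (by omega)
  have h6 := h (8 * k + 6) (by omega) (by omega)
  have h7 := h (8 * k + 7) (by omega) (by omega)
  simp only [u0, u1, u2, u3, u4, u5, u6, u7, add_assoc, Nat.reduceAdd] at h0 h1 h2 h3 h4 h5 h6 h7
  have hab : q (u k) * q (1 - u k) = 2 := by
    generalize u k = e
    fin_cases e
    · simpa using hq
    · simpa [mul_comm] using hq
  generalize q (u k) = a at *
  generalize q (1 - u k) = b at *
  -- The coefficients read `ab·ba·ba·ab`. The middle `ba·ba` is the square of a trace-zero matrix of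
  -- determinant `1`, which gives the sign change from `2, 3` to `6, 7`; the two outer `ab` then
  -- contribute another `-1`.
  have e3 : g (8 * k + 3) = g (8 * k + 1) - b * g (8 * k) := by
    linear_combination h1 + b * h0 + g (8 * k + 1) * hab
  have e5 : g (8 * k + 5) = g (8 * k + 3) - a * g (8 * k + 2) := by
    linear_combination h3 + a * h2 + g (8 * k + 3) * hab
  have e6 : g (8 * k + 6) = - g (8 * k + 2) := by
    linear_combination h4 + b * e5 - h2 - g (8 * k + 2) * hab
  have e7 : g (8 * k + 7) = - g (8 * k + 3) := by
    linear_combination h5 + a * e6 - e5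
  have e8 : g (8 * k + 8) = g (8 * k) := by
    linear_combination h6 + a * e7 - e6 - a * e3 + h0 + g (8 * k) * hab
  exact ⟨e8, by linear_combination h7 + b * e8 - e7 + e3⟩

/-- A sequence that changes at most by a factor `L` per step and returns to its value over aligned
blocks of length `8` is comparable to itself at any two points. -/
lemma le_pow_mul_of_block {v : ℕ → ℝ} {L : ℝ} {a b : ℕ} (hL : 1 ≤ L) (hv : ∀ x, 0 ≤ v x)
    (hs : ∀ x, a ≤ x → x < b → v (x + 1) ≤ L * v x ∧ v x ≤ L * v (x + 1))
    (hb : ∀ k, a ≤ 8 * k → 8 * k + 8 ≤ b → v (8 * k + 8) = v (8 * k))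
    {m n : ℕ} (hm : a ≤ m) (hmn : m ≤ n) (hn : n ≤ b) :
    v n ≤ L ^ 16 * v m ∧ v m ≤ L ^ 16 * v n := by
  have step : ∀ (d x : ℕ), a ≤ x → x + d ≤ b →
      v (x + d) ≤ L ^ d * v x ∧ v x ≤ L ^ d * v (x + d) := by
    intro d
    induction d with
    | zero => intro x _ _; simp
    | succ d ih =>
      intro x hx hxd
      obtain ⟨i1, i2⟩ := ih x hx (by omega)
      obtain ⟨s1, s2⟩ := hs (x + d) (by omega) (by omega)
      have hp : 0 ≤ L ^ d := by positivity
      rw [← add_assoc, pow_succ]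
      constructor
      · nlinarith
      · nlinarith [mul_le_mul_of_nonneg_left s2 hp]
  have near : ∀ (d x : ℕ), d ≤ 8 → a ≤ x → x + d ≤ b →
      v (x + d) ≤ L ^ 8 * v x ∧ v x ≤ L ^ 8 * v (x + d) := by
    intro d x hd hx hxd
    obtain ⟨i1, i2⟩ := step d x hx hxd
    have hp : L ^ d ≤ L ^ 8 := pow_le_pow_right₀ hL hd
    exact ⟨i1.trans (mul_le_mul_of_nonneg_right hp (hv _)),
      i2.trans (mul_le_mul_of_nonneg_right hp (hv _))⟩
  have far : ∀ d p : ℕ, a ≤ 8 * p → 8 * (p + d) ≤ b → v (8 * (p + d)) = v (8 * p) := by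
    intro d p hp
    induction d with
    | zero => intro _; rfl
    | succ d ih =>
      intro h
      rw [← ih (by omega), ← hb (p + d) (by omega) (by omega)]
      congr 1
  -- The exponent `16` is `8 + 8`: at most `8` steps from `m` up to a multiple of `8`, no change
  -- between multiples of `8`, and at most `8` steps from the last multiple to `n`.
  have h8 : (1 : ℝ) ≤ L ^ 8 := one_le_pow₀ hL
  have h16 : L ^ 16 = L ^ 8 * L ^ 8 := by ring
  rw [h16]
  by_cases hd : n ≤ m + 8
  · obtain ⟨d, rfl⟩ := Nat.exists_eq_add_of_le hmn
    obtain ⟨i1, i2⟩ := near d m (by omega) hm hn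
    have h88 : L ^ 8 ≤ L ^ 8 * L ^ 8 := le_mul_of_one_le_left (by positivity) h8
    exact ⟨i1.trans (mul_le_mul_of_nonneg_right h88 (hv _)),
      i2.trans (mul_le_mul_of_nonneg_right h88 (hv _))⟩
  · obtain ⟨p, hp⟩ : ∃ p, p = (m + 7) / 8 := ⟨_, rfl⟩
    obtain ⟨d, hd'⟩ : ∃ d, d = n / 8 - p := ⟨_, rfl⟩
    have e1 := near (8 * p - m) m (by omega) hm (by omega)
    rw [show m + (8 * p - m) = 8 * p by omega] at e1
    have e2 := near (n - 8 * (p + d)) (8 * (p + d)) (by omega) (by omega) (by omega)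
    rw [show 8 * (p + d) + (n - 8 * (p + d)) = n by omega, far d p (by omega) (by omega)] at e2
    have hp8 : 0 ≤ L ^ 8 := by positivity
    constructor
    · rw [mul_assoc]
      exact e2.1.trans (mul_le_mul_of_nonneg_left e1.1 hp8)
    · rw [mul_assoc]
      exact e1.2.trans (mul_le_mul_of_nonneg_left e2.2 hp8)

/-- At coefficients with product `2`, solutions of the recursion on a window of `u` are bounded
above and below, uniformly in the window. -/
lemma recursion_bounded {q : Fin 2 → ℂ} (hq : q 0 * q 1 = 2) {L : ℝ} (hL : ∀ e, ‖q e‖ + 1 ≤ L)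
    {g : ℕ → ℂ} {a b : ℕ}
    (h : ∀ x, a ≤ x → x < b → g (x + 2) = q (u x) * g (x + 1) - g x)
    {m n : ℕ} (hm : a ≤ m) (hmn : m ≤ n) (hn : n ≤ b) :
    max ‖g n‖ ‖g (n + 1)‖ ≤ L ^ 16 * max ‖g m‖ ‖g (m + 1)‖ ∧
    max ‖g m‖ ‖g (m + 1)‖ ≤ L ^ 16 * max ‖g n‖ ‖g (n + 1)‖ := by
  have hL1 : 1 ≤ L := le_trans (by linarith [norm_nonneg (q 0)]) (hL 0)
  have bound : ∀ (e : Fin 2) (x y : ℂ), ‖q e * x - y‖ ≤ L * max ‖x‖ ‖y‖ := by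
    intro e x y
    have := norm_sub_le (q e * x) y
    rw [norm_mul] at this
    have h1 := mul_le_mul_of_nonneg_left (le_max_left ‖x‖ ‖y‖) (norm_nonneg (q e))
    have h2 := le_max_right ‖x‖ ‖y‖
    have h3 := mul_le_mul_of_nonneg_right (hL e) ((norm_nonneg x).trans (le_max_left ‖x‖ ‖y‖))
    linarith
  have triv : ∀ x : ℝ, 0 ≤ x → x ≤ L * x := fun x hx => le_mul_of_one_le_left hx hL1
  refine le_pow_mul_of_block (v := fun x => max ‖g x‖ ‖g (x + 1)‖) hL1
    (fun x => le_max_of_le_left (norm_nonneg _)) (fun x hx hxb => ?_) (fun k hk hkb => ?_)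
    hm hmn hn
  · have e := h x hx hxb
    have e' : g x = q (u x) * g (x + 1) - g (x + 2) := by rw [e]; ring
    constructor
    · refine max_le ((le_max_right _ _).trans (triv _ (le_max_of_le_left (norm_nonneg _)))) ?_
      rw [show x + 1 + 1 = x + 2 from rfl, e, max_comm]
      exact bound _ _ _
    · refine max_le ?_ ((le_max_left _ _).trans (triv _ (le_max_of_le_left (norm_nonneg _))))
      conv_lhs => rw [e']
      exact bound _ _ _
  · obtain ⟨e1, e2⟩ := recursion_block_eq hq (k := k) (g := g)
      (fun x h1 h2 => h x (by omega) (by omega))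
    simp only [show 8 * k + 8 + 1 = 8 * k + 9 from rfl, e1, e2]

end ThueMorse

/-! ### Stability of bounded solutions under a complex perturbation of the energy -/

namespace DiscreteSchrodinger

/-- The solutions of the eigenvalue equation with potential `V` at energy `E` on a half-line to the
right are bounded by `K` times their initial data, uniformly in the half-line. -/
def BoundedSolutions (V : ℤ → ℝ) (E K : ℝ) : Prop :=
  ∀ (φ : ℤ → ℂ) (j : ℤ), (∀ i, j < i → φ (i + 1) + φ (i - 1) + V i * φ i = E * φ i) →
    ∀ n, j ≤ n → ‖φ n‖ ≤ K * max ‖φ j‖ ‖φ (j + 1)‖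

lemma exists_solution (V : ℤ → ℝ) (E : ℝ) (j : ℤ) (x y : ℂ) :
    ∃ φ : ℤ → ℂ, φ j = x ∧ φ (j + 1) = y ∧
      ∀ i, j < i → φ (i + 1) + φ (i - 1) + V i * φ i = E * φ i := by
  -- `F m` holds the values at `j + m` and `j + m + 1`. To the left of `j`, `toNat` repeats the
  -- value at `j`, which is harmless because the equation is required only beyond `j`.
  let F : ℕ → ℂ × ℂ := fun n => Nat.rec (x, y)
    (fun m s => (s.2, ((E : ℂ) - V (j + m + 1)) * s.2 - s.1)) n
  have hF : ∀ m, F (m + 1) = ((F m).2, ((E : ℂ) - V (j + m + 1)) * (F m).2 - (F m).1) :=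
    fun _ => rfl
  refine ⟨fun i => (F (i - j).toNat).1, by simp [F], ?_, fun i hi => ?_⟩
  · have : (j + 1 - j).toNat = 0 + 1 := by omega
    simp only [this, hF]
    rfl
  · obtain ⟨m, hm⟩ : ∃ m : ℕ, i = j + m + 1 := ⟨(i - j - 1).toNat, by omega⟩
    have h0 : (i - 1 - j).toNat = m := by omega
    have h1 : (i - j).toNat = m + 1 := by omega
    have h2 : (i + 1 - j).toNat = m + 1 + 1 := by omega
    simp only [h0, h1, h2, hF]
    rw [hm]
    ring

/-- A solution at a complex energy `z` near an energy `E` with bounded solutions cannot decay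
quickly: the deviation is controlled by the Wronskian with solutions at energy `E`. -/
lemma BoundedSolutions.norm_le {V : ℤ → ℝ} {E K : ℝ} (hV : BoundedSolutions V E K) (hK : 0 ≤ K)
    {z : ℂ} {ψ : ℤ → ℂ} (hψ : ∀ i, 1 < i → ψ (i + 1) + ψ (i - 1) + V i * ψ i = z * ψ i)
    (n : ℤ) (k : ℕ) (hk : 1 ≤ n - k) :
    max ‖ψ (n - k)‖ ‖ψ (n - k + 1)‖ ≤
      2 * K * (1 + ‖z - E‖ * K) ^ k * max ‖ψ n‖ ‖ψ (n + 1)‖ := by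
  have key : ∀ k : ℕ, 1 ≤ n - k → max ‖ψ (n - k)‖ ‖ψ (n - k + 1)‖ ≤
      2 * K * max ‖ψ n‖ ‖ψ (n + 1)‖ + ‖z - E‖ * K *
        ∑ l ∈ Finset.range k, max ‖ψ (n - l)‖ ‖ψ (n - l + 1)‖ := by
    intro k hk
    -- The Wronskian of `ψ` with a solution `φ` at energy `E` would be constant if `z = E`; each
    -- step to the left changes it by `(z - E) φ ψ`.
    have wr : ∀ φ : ℤ → ℂ, max ‖φ (n - k)‖ ‖φ (n - k + 1)‖ ≤ 1 →
        (∀ i, n - k < i → φ (i + 1) + φ (i - 1) + V i * φ i = E * φ i) →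
        ‖ψ (n - k + 1) * φ (n - k) - ψ (n - k) * φ (n - k + 1)‖ ≤
        2 * K * max ‖ψ n‖ ‖ψ (n + 1)‖ + ‖z - E‖ * K *
        ∑ l ∈ Finset.range k, max ‖ψ (n - l)‖ ‖ψ (n - l + 1)‖ := by
      intro φ h1 hφ
      have hb : ∀ i, n - k ≤ i → ‖φ i‖ ≤ K := fun i hi =>
        (hV φ _ hφ i hi).trans (mul_le_of_le_one_right hK h1)
      have ind : ∀ l : ℕ, l ≤ k →
          ‖ψ (n - l + 1) * φ (n - l) - ψ (n - l) * φ (n - l + 1)‖ ≤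
          2 * K * max ‖ψ n‖ ‖ψ (n + 1)‖ + ‖z - E‖ * K *
          ∑ s ∈ Finset.range l, max ‖ψ (n - s)‖ ‖ψ (n - s + 1)‖ := by
        intro l
        induction l with
        | zero =>
          intro _
          simp only [Nat.cast_zero, sub_zero, Finset.range_zero, Finset.sum_empty, mul_zero,
            add_zero]
          refine (norm_sub_le _ _).trans ?_
          rw [norm_mul, norm_mul]
          have i1 := mul_le_mul (le_max_right ‖ψ n‖ ‖ψ (n + 1)‖) (hb n (by omega))
            (norm_nonneg _) (le_max_of_le_left (norm_nonneg _))
          have i2 := mul_le_mul (le_max_left ‖ψ n‖ ‖ψ (n + 1)‖) (hb (n + 1) (by omega))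
            (norm_nonneg _) (le_max_of_le_left (norm_nonneg _))
          linarith
        | succ l ih =>
          intro hl
          have e1 := hψ (n - l) (by omega)
          have e2 := hφ (n - l) (by omega)
          have e : ψ (n - (l + 1 : ℕ) + 1) * φ (n - (l + 1 : ℕ)) -
              ψ (n - (l + 1 : ℕ)) * φ (n - (l + 1 : ℕ) + 1) =
              (ψ (n - l + 1) * φ (n - l) - ψ (n - l) * φ (n - l + 1)) -
              (z - E) * φ (n - l) * ψ (n - l) := by
            rw [show n - ((l + 1 : ℕ) : ℤ) + 1 = n - l by push_cast; ring,
              show n - ((l + 1 : ℕ) : ℤ) = n - l - 1 by push_cast; ring]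
            linear_combination ψ (n - l) * e2 - φ (n - l) * e1
          rw [e, Finset.sum_range_succ]
          refine (norm_sub_le _ _).trans ?_
          rw [norm_mul, norm_mul]
          have i1 := mul_le_mul (mul_le_mul_of_nonneg_left (hb (n - l) (by omega))
            (norm_nonneg (z - E))) (le_max_left ‖ψ (n - l)‖ ‖ψ (n - l + 1)‖)
            (norm_nonneg _) (by positivity)
          have := ih (by omega)
          linarith
      exact ind k le_rfl
    refine max_le ?_ ?_
    -- With data `(0, 1)` at `n - k` the Wronskian is `-ψ (n - k)`; with data `(1, 0)` it is `ψ (n -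
    -- k + 1)`.
    · obtain ⟨φ, h0, h1, h⟩ := exists_solution V E (n - k) 0 1
      have := wr φ (by simp [h0, h1]) h
      simpa [h0, h1] using this
    · obtain ⟨φ, h0, h1, h⟩ := exists_solution V E (n - k) 1 0
      have := wr φ (by simp [h0, h1]) h
      simpa [h0, h1] using this
  have hδ : 0 ≤ ‖z - E‖ * K := by positivity
  revert hk
  induction k using Nat.strong_induction_on with
  | _ k ih =>
    intro hk
    refine (key k hk).trans ?_
    -- Discrete Gronwall: inserting the inductive bounds in `key` leaves a geometric sum, which
    -- closes exactly.
    have hs : ∑ l ∈ Finset.range k, max ‖ψ (n - l)‖ ‖ψ (n - l + 1)‖ ≤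
        ∑ l ∈ Finset.range k,
          (1 + ‖z - E‖ * K) ^ l * (2 * K * max ‖ψ n‖ ‖ψ (n + 1)‖) := by
      refine Finset.sum_le_sum fun l hl => ?_
      have hl' := Finset.mem_range.1 hl
      refine (ih l hl' (by omega)).trans (le_of_eq (by ring))
    refine (add_le_add_right (mul_le_mul_of_nonneg_left hs hδ) _).trans (le_of_eq ?_)
    have hg := geom_sum_mul (1 + ‖z - E‖ * K) k
    rw [← Finset.sum_mul]
    linear_combination (2 * K * max ‖ψ n‖ ‖ψ (n + 1)‖) * hg

end DiscreteSchrodinger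

/-! ### Bounded solutions for the subshift, in both directions -/

namespace ThueMorse

open DiscreteSchrodinger

section Bounded

variable {lam E : ℝ} {ω : ℤ → Fin 2} {L : ℝ}

lemma coeff_norm_le (hL : |E| + |lam| + 1 ≤ L) (e : Fin 2) :
    ‖((E - lam * ((e : ℕ) : ℝ) : ℝ) : ℂ)‖ + 1 ≤ L := by
  rw [Complex.norm_real, Real.norm_eq_abs]
  have h2 := abs_sub E (lam * ((e : ℕ) : ℝ))
  fin_cases e <;> simp at h2 ⊢ <;> linarith [abs_nonneg lam]

lemma boundedSolutions (hω : ω ∈ subshift) (hE : E * (E - lam) = 2)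
    (hL : |E| + |lam| + 1 ≤ L) : BoundedSolutions (potential lam ω) E (L ^ 16) := by
  intro φ j hφ n hn
  obtain ⟨l, rfl⟩ : ∃ l : ℕ, n = j + l := ⟨(n - j).toNat, by omega⟩
  obtain ⟨a, ha⟩ := hω (j + 1) l
  have hq : (fun e : Fin 2 => ((E - lam * ((e : ℕ) : ℝ) : ℝ) : ℂ)) 0 *
      (fun e : Fin 2 => ((E - lam * ((e : ℕ) : ℝ) : ℝ) : ℂ)) 1 = 2 := by
    simp only [← Complex.ofReal_mul]
    simpa using congrArg (fun r : ℝ => (r : ℂ)) hE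
  -- The value at `j` is placed at index `a`. The letter `u x` belongs to the middle index `x + 1`
  -- of the recursion, so the window of `ω` starts at `j + 1`.
  have := (recursion_bounded hq (coeff_norm_le hL) (g := fun x : ℕ => φ (j + (x - a)))
    (a := a) (b := a + l) (fun x hx hxl => ?_) (m := a) (n := a + l) le_rfl
    (by omega) le_rfl).1
  · refine (le_of_eq ?_).trans ((le_max_left _ _).trans (this.trans (le_of_eq ?_)))
    · simp
    · simp
  · obtain ⟨i, rfl⟩ := Nat.exists_eq_add_of_le hx
    have e := hφ (j + 1 + i) (by omega)
    simp only [potential, ha i (by omega)] at e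
    push_cast at e ⊢
    rw [show j + 1 + (i : ℤ) + 1 = j + (a + i + 2 - a) by ring,
      show j + 1 + (i : ℤ) - 1 = j + (a + i - a) by ring,
      show j + 1 + (i : ℤ) = j + (a + i + 1 - a) by ring] at e
    linear_combination e

/-- This serves the left half-line. Reflection invariance of the subshift is not needed: the
solution is read backwards along a window of `u`, and the estimate of data at the start by data at
the end, the second half of `recursion_bounded`, applies. -/
lemma boundedSolutions_reflect (hω : ω ∈ subshift) (hE : E * (E - lam) = 2)
    (hL : |E| + |lam| + 1 ≤ L) (c : ℤ) :
    BoundedSolutions (fun i => potential lam ω (c - i)) E (L ^ 16) := by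
  intro φ j hφ n hn
  obtain ⟨l, rfl⟩ : ∃ l : ℕ, n = j + l := ⟨(n - j).toNat, by omega⟩
  obtain ⟨a, ha⟩ := hω (c - j - l) l
  have hq : (fun e : Fin 2 => ((E - lam * ((e : ℕ) : ℝ) : ℝ) : ℂ)) 0 *
      (fun e : Fin 2 => ((E - lam * ((e : ℕ) : ℝ) : ℝ) : ℂ)) 1 = 2 := by
    simp only [← Complex.ofReal_mul]
    simpa using congrArg (fun r : ℝ => (r : ℂ)) hE
  have := (recursion_bounded hq (coeff_norm_le hL) (g := fun x : ℕ => φ (j + 1 + a + l - x))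
    (a := a) (b := a + l) (fun x hx hxl => ?_) (m := a) (n := a + l) le_rfl
    (by omega) le_rfl).2
  · refine le_trans ?_ (this.trans (le_of_eq ?_))
    · refine (le_of_eq ?_).trans (le_max_right _ _)
      congr 2
      push_cast
      ring
    · rw [max_comm]
      congr 3
      · congr 2; push_cast; ring
      · congr 2; push_cast; ring
  · obtain ⟨i, rfl⟩ := Nat.exists_eq_add_of_le hx
    have e := hφ (j + l - i) (by omega)
    have hc : c - (j + l - (i : ℤ)) = c - j - l + i := by ring
    simp only [potential, hc, ha i (by omega)] at e
    push_cast at e ⊢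
    rw [show j + l - (i : ℤ) + 1 = j + 1 + a + l - (a + i) by ring,
      show j + l - (i : ℤ) - 1 = j + 1 + a + l - (a + i + 2) by ring,
      show j + l - (i : ℤ) = j + 1 + a + l - (a + i + 1) by ring] at e
    linear_combination e

end Bounded

end ThueMorse
-- The Green function as a Laplace transform of the evolution
namespace DiscreteSchrodinger

open MeasureTheory Filter Topology

variable {V : ℤ → ℝ} (hV : BddAbove (Set.range fun n => |V n|))

lemma inner_shift (k : ℤ) (x y : H2) : inner ℂ (shift k x) y = inner ℂ x (shift (-k) y) := by
  rw [lp.inner_eq_tsum, lp.inner_eq_tsum, ← (Equiv.addRight k).tsum_eq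
    (fun n : ℤ => inner ℂ (x n) (shift (-k) y n))]
  refine tsum_congr fun n => ?_
  change inner ℂ (x (n + k)) (y n) = inner ℂ (x (n + k)) (y (n + k + -k))
  simp

lemma inner_mulPotential (x y : H2) :
    inner ℂ (mulPotential V hV x) y = inner ℂ x (mulPotential V hV y) := by
  rw [lp.inner_eq_tsum, lp.inner_eq_tsum]
  refine tsum_congr fun n => ?_
  change inner ℂ ((V n : ℂ) * x n) (y n) = inner ℂ (x n) ((V n : ℂ) * y n)
  simp only [RCLike.inner_apply, map_mul, Complex.conj_ofReal]
  ring

lemma isSelfAdjoint_hamiltonian : IsSelfAdjoint (hamiltonian V hV) := by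
  rw [ContinuousLinearMap.isSelfAdjoint_iff_isSymmetric]
  intro x y
  change inner ℂ (shift (-1) x + shift 1 x + mulPotential V hV x) y =
    inner ℂ x (shift (-1) y + shift 1 y + mulPotential V hV y)
  simp only [inner_add_left, inner_add_right, inner_shift, inner_mulPotential, neg_neg]
  ring

lemma norm_evolve {H : H2 →L[ℂ] H2} (hH : IsSelfAdjoint H) (t : ℝ) (ψ : H2) :
    ‖evolve H t ψ‖ = ‖ψ‖ := by
  have hs : IsSelfAdjoint ((-t : ℂ) • H) := by
    refine IsSelfAdjoint.smul ?_ hH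
    simp [IsSelfAdjoint]
  have hu := (selfAdjoint.expUnitary ⟨(-t : ℂ) • H, selfAdjoint.mem_iff.2 hs⟩).2
  rw [selfAdjoint.expUnitary_coe] at hu
  have he : Complex.I • ((-t : ℂ) • H) = (-(Complex.I * (t : ℂ))) • H := by
    rw [smul_smul]; congr 1; ring
  simp only [he] at hu
  exact ContinuousLinearMap.norm_map_of_mem_unitary hu ψ

lemma norm_delta (m : ℤ) : ‖delta m‖ = 1 := by
  rw [delta, lp.norm_single (by norm_num)]; simp

lemma norm_evolve_apply_le {H : H2 →L[ℂ] H2} (hH : IsSelfAdjoint H) (t : ℝ) (n : ℤ) :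
    ‖evolve H t (delta 1) n‖ ≤ 1 := by
  have := lp.norm_apply_le_norm (p := 2) (by norm_num) (evolve H t (delta 1)) n
  rwa [norm_evolve hH, norm_delta] at this

lemma hasDerivAt_evolve (H : H2 →L[ℂ] H2) (t : ℝ) (ψ : H2) :
    HasDerivAt (fun s : ℝ => evolve H s ψ) (-Complex.I • H (evolve H t ψ)) t := by
  have h1 := hasDerivAt_exp_smul_const' (𝕂 := ℂ) H (-(Complex.I * (t : ℂ)))
  have h2 : HasDerivAt (fun s : ℝ => -(Complex.I * (s : ℂ))) (-(Complex.I)) t := by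
    simpa using ((Complex.ofRealCLM.hasDerivAt (x := t)).const_mul Complex.I).fun_neg
  have h3 := h1.scomp t h2
  have h4 := ((ContinuousLinearMap.apply ℂ H2 ψ).restrictScalars ℝ).hasFDerivAt.comp_hasDerivAt t h3
  exact h4

/-- Evaluation of an `ℓ²` sequence at a site. -/
noncomputable def evalCLM (n : ℤ) : H2 →L[ℂ] ℂ :=
  LinearMap.mkContinuous
    { toFun := fun ψ => ψ n
      map_add' := fun _ _ => rfl
      map_smul' := fun _ _ => rfl } 1
    (fun ψ => by rw [one_mul]; exact lp.norm_apply_le_norm (p := 2) (by norm_num) ψ n)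

lemma hasDerivAt_evolve_apply (t : ℝ) (ψ : H2) (n : ℤ) :
    HasDerivAt (fun s : ℝ => evolve (hamiltonian V hV) s ψ n)
      (-Complex.I * (evolve (hamiltonian V hV) t ψ (n - 1) +
        evolve (hamiltonian V hV) t ψ (n + 1) + V n * evolve (hamiltonian V hV) t ψ n)) t :=
  ((evalCLM n).restrictScalars ℝ).hasFDerivAt.comp_hasDerivAt t
    (hasDerivAt_evolve (hamiltonian V hV) t ψ)

lemma norm_exp_mul_le {z : ℂ} {t : ℝ} {w : ℂ} (hw : ‖w‖ ≤ 1) :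
    ‖Complex.exp (Complex.I * z * t) * w‖ ≤ Real.exp (-z.im * t) := by
  rw [norm_mul, Complex.norm_exp]
  have : (Complex.I * z * t).re = -z.im * t := by simp
  rw [this]
  exact mul_le_of_le_one_right (Real.exp_pos _).le hw

lemma continuous_evolve_apply (n : ℤ) :
    Continuous (fun s : ℝ => evolve (hamiltonian V hV) s (delta 1) n) :=
  continuous_iff_continuousAt.2 fun t => (hasDerivAt_evolve_apply hV t (delta 1) n).continuousAt

lemma integrableOn_laplace {z : ℂ} (hz : 0 < z.im) (n : ℤ) :
    IntegrableOn (fun t : ℝ => Complex.exp (Complex.I * z * t) *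
      evolve (hamiltonian V hV) t (delta 1) n) (Set.Ioi 0) := by
  have := continuous_evolve_apply hV n
  refine Integrable.mono' (integrableOn_exp_mul_Ioi (neg_lt_zero.2 hz) 0) ?_ ?_
  · exact Continuous.aestronglyMeasurable (by fun_prop)
  · exact Eventually.of_forall fun t =>
      norm_exp_mul_le (norm_evolve_apply_le (isSelfAdjoint_hamiltonian hV) t n)

/-- The Green function `⟨δ_n, (H - z)⁻¹ δ_1⟩`, written as a Laplace transform of the evolution. -/
noncomputable def green (z : ℂ) (n : ℤ) : ℂ :=
  Complex.I * ∫ t in Set.Ioi (0 : ℝ), Complex.exp (Complex.I * z * t) *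
    evolve (hamiltonian V hV) t (delta 1) n

/-- Integrate the derivative of `e^{izt} (e^{-itH} δ_1)(n)` over the half-line: unitarity and `Im z
> 0` remove the boundary term at infinity, and the one at `0` is the source `δ_1(n)`. -/
lemma green_eq {z : ℂ} (hz : 0 < z.im) (n : ℤ) :
    green hV z (n + 1) + green hV z (n - 1) + V n * green hV z n =
      z * green hV z n + if n = 1 then 1 else 0 := by
  set f : ℤ → ℝ → ℂ := fun n t => Complex.exp (Complex.I * z * t) *
    evolve (hamiltonian V hV) t (delta 1) n with hf
  have hi : ∀ m, IntegrableOn (f m) (Set.Ioi 0) := integrableOn_laplace hV hz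
  have hd : ∀ t : ℝ, HasDerivAt (f n) (Complex.I * z * f n t -
      Complex.I * (f (n - 1) t + f (n + 1) t + V n * f n t)) t := by
    intro t
    have h1 : HasDerivAt (fun t : ℝ => Complex.I * z * t) (Complex.I * z) t := by
      simpa using (Complex.ofRealCLM.hasDerivAt (x := t)).const_mul (Complex.I * z)
    have h2 := h1.cexp.mul (hasDerivAt_evolve_apply hV t (delta 1) n)
    refine HasDerivAt.congr_deriv h2 ?_
    simp only [hf]
    ring
  have ht : Tendsto (f n) atTop (𝓝 0) := by
    refine squeeze_zero_norm (fun t => norm_exp_mul_le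
      (norm_evolve_apply_le (isSelfAdjoint_hamiltonian hV) t n)) ?_
    refine Real.tendsto_exp_atBot.comp ?_
    exact tendsto_id.const_mul_atTop_of_neg (neg_lt_zero.2 hz)
  have i1 : IntegrableOn (fun t => Complex.I * z * f n t) (Set.Ioi 0) := (hi n).const_mul _
  have i2 : IntegrableOn (fun t => f (n - 1) t + f (n + 1) t) (Set.Ioi 0) :=
    (hi (n - 1)).add (hi (n + 1))
  have i3 : IntegrableOn (fun t => V n * f n t) (Set.Ioi 0) := (hi n).const_mul _
  have i4 : IntegrableOn (fun t => f (n - 1) t + f (n + 1) t + V n * f n t) (Set.Ioi 0) :=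
    i2.add i3
  have i5 := i4.const_mul Complex.I
  have h := integral_Ioi_of_hasDerivAt_of_tendsto (hd 0).continuousAt.continuousWithinAt
    (fun t _ => hd t) (i1.sub i5) ht
  have h0 : f n 0 = if n = 1 then 1 else 0 := by
    simp only [hf, evolve, delta]
    by_cases hn : n = 1
    · subst hn; simp
    · simp [hn]
  rw [integral_sub i1 i5, integral_const_mul, integral_const_mul, integral_add i2 i3,
    integral_add (hi _) (hi _), integral_const_mul, h0] at h
  have hg : ∀ m, green hV z m = Complex.I * ∫ t in Set.Ioi (0 : ℝ), f m t := fun _ => rfl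
  rw [hg, hg, hg]
  linear_combination -h

/-- Cauchy–Schwarz for the weight `e^{-2t/T}`, whose total mass is `T/2`. The imaginary part `2/T`
is chosen so that the Laplace kernel has the same modulus as the averaging weight. -/
lemma sq_norm_green_le {E T : ℝ} (hT : 0 < T) (n : ℤ) :
    ENNReal.ofReal (2 / T ^ 2 * ‖green hV (E + (2 / T : ℝ) * Complex.I) n‖ ^ 2) ≤
      timeAvgProb (hamiltonian V hV) n T := by
  have hs : IsSelfAdjoint (hamiltonian V hV) := isSelfAdjoint_hamiltonian hV
  set z : ℂ := E + (2 / T : ℝ) * Complex.I with hz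
  have him : z.im = 2 / T := by simp [hz]
  have hpos : 0 < 2 / T := by positivity
  set a : ℝ → ℝ := fun t => ‖evolve (hamiltonian V hV) t (delta 1) n‖ with ha
  have hac : Continuous a := (continuous_evolve_apply hV n).norm
  have ha1 : ∀ t, ‖a t‖ ≤ 1 := fun t => by
    simpa [ha] using norm_evolve_apply_le hs t n
  set e : ℝ → ℝ := fun t => Real.exp (-(2 / T) * t) with he
  have hec : Continuous e := by fun_prop
  have hei : IntegrableOn e (Set.Ioi 0) := integrableOn_exp_mul_Ioi (neg_lt_zero.2 hpos) 0
  have hei' : ∫ t in Set.Ioi (0 : ℝ), e t = T / 2 := by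
    rw [he, integral_exp_mul_Ioi (neg_lt_zero.2 hpos) 0]
    simp
  have h1 : IntegrableOn (fun t => e t * a t) (Set.Ioi 0) := by
    refine hei.mono' (hec.mul hac).aestronglyMeasurable (Eventually.of_forall fun t => ?_)
    rw [norm_mul, Real.norm_eq_abs (e t), abs_of_pos (Real.exp_pos _)]
    exact mul_le_of_le_one_right (Real.exp_pos _).le (ha1 t)
  have h2 : IntegrableOn (fun t => e t * a t ^ 2) (Set.Ioi 0) := by
    refine hei.mono' (hec.mul (hac.pow 2)).aestronglyMeasurable (Eventually.of_forall fun t => ?_)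
    rw [norm_mul, norm_pow, Real.norm_eq_abs (e t), abs_of_pos (Real.exp_pos _)]
    exact mul_le_of_le_one_right (Real.exp_pos _).le (pow_le_one₀ (norm_nonneg _) (ha1 t))
  set A := ∫ t in Set.Ioi (0 : ℝ), e t * a t with hA
  set B := ∫ t in Set.Ioi (0 : ℝ), e t * a t ^ 2 with hB
  have hG : ‖green hV z n‖ ≤ A := by
    rw [green, norm_mul, Complex.norm_I, one_mul]
    refine (norm_integral_le_integral_norm _).trans (le_of_eq ?_)
    refine integral_congr_ae (Eventually.of_forall fun t => ?_)
    simp only [norm_mul, Complex.norm_exp, he, ha]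
    congr 2
    simp [him]
  have hAB : 2 / T * A ^ 2 ≤ B := by
    -- `2 / T * A` is the mean of `a` for the normalized weight, so this is the nonnegativity of a
    -- variance.
    have hnn : 0 ≤ ∫ t in Set.Ioi (0 : ℝ), e t * (a t - 2 / T * A) ^ 2 :=
      integral_nonneg fun t => mul_nonneg (Real.exp_pos _).le (sq_nonneg _)
    have hx : ∫ t in Set.Ioi (0 : ℝ), e t * (a t - 2 / T * A) ^ 2 =
        B - 2 * (2 / T * A) * A + (2 / T * A) ^ 2 * (T / 2) := by
      generalize 2 / T * A = c
      have j1 : IntegrableOn (fun t => 2 * c * (e t * a t)) (Set.Ioi 0) := h1.const_mul _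
      have j2 : IntegrableOn (fun t => c ^ 2 * e t) (Set.Ioi 0) := hei.const_mul _
      have j3 : IntegrableOn (fun t => e t * a t ^ 2 - 2 * c * (e t * a t)) (Set.Ioi 0) :=
        h2.sub j1
      rw [hB, hA, ← hei', ← integral_const_mul, ← integral_const_mul, ← integral_sub h2 j1,
        ← integral_add j3 j2]
      refine integral_congr_ae (Eventually.of_forall fun t => ?_)
      simp only
      ring
    rw [hx] at hnn
    have : (2 / T * A) ^ 2 * (T / 2) = 2 / T * A ^ 2 := by field_simp
    rw [this] at hnn
    linarith
  have hB' : ∫⁻ t in Set.Ioi (0 : ℝ), ENNReal.ofReal (Real.exp (-2 * t / T) *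
      ‖evolve (hamiltonian V hV) t (delta 1) n‖ ^ 2) = ENNReal.ofReal B := by
    rw [hB, ofReal_integral_eq_lintegral_ofReal h2 (Eventually.of_forall fun t =>
      mul_nonneg (Real.exp_pos _).le (sq_nonneg _))]
    refine lintegral_congr fun t => ?_
    simp only [he, ha]
    congr 3
    ring
  rw [timeAvgProb, hB', ← ENNReal.ofReal_mul (by positivity)]
  refine ENNReal.ofReal_le_ofReal ?_
  have hsq : ‖green hV z n‖ ^ 2 ≤ A ^ 2 := pow_le_pow_left₀ (norm_nonneg _) hG 2
  calc 2 / T ^ 2 * ‖green hV z n‖ ^ 2 ≤ 2 / T ^ 2 * A ^ 2 := by gcongr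
    _ = 1 / T * (2 / T * A ^ 2) := by field_simp
    _ ≤ 1 / T * B := by gcongr

end DiscreteSchrodinger

/-! ### From Green function bounds to moments and growth exponents -/

namespace DiscreteSchrodinger

open Filter Topology

lemma sum_range_pair (F : ℕ → ℝ≥0∞) (M : ℕ) :
    ∑ x ∈ Finset.range M, (F (2 * x) + F (2 * x + 1)) = ∑ y ∈ Finset.range (2 * M), F y := by
  induction M with
  | zero => simp
  | succ M ih =>
    rw [Finset.sum_range_succ, ih, show 2 * (M + 1) = 2 * M + 1 + 1 by ring,
      Finset.sum_range_succ, Finset.sum_range_succ, add_assoc]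

/-- A lower bound for the Green function on a half-line of length `T`, enumerated by `s`, bounds
the moments from below. -/
lemma le_moment {V : ℤ → ℝ} (hV : BddAbove (Set.range fun n => |V n|)) {E p T c : ℝ}
    (hp : 0 < p) (hT : 16 ≤ T) (hc : 0 ≤ c) {s : ℕ → ℤ} (hs : Function.Injective s)
    (hs' : ∀ n : ℕ, (n : ℝ) - 2 ≤ |(s n : ℝ)|)
    (hg : ∀ n : ℕ, 1 ≤ n → (n : ℝ) ≤ T →
      c ≤ ‖green hV (E + (2 / T : ℝ) * Complex.I) (s n)‖ ^ 2 +
        ‖green hV (E + (2 / T : ℝ) * Complex.I) (s (n + 1))‖ ^ 2) :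
    ENNReal.ofReal (T / 8 * ((T / 4) ^ p * (2 / T ^ 2) * c)) ≤ moment (hamiltonian V hV) p T := by
  -- The sum is restricted to indices from `2M` to `4M - 1` with `M = ⌊T/4⌋`. They stay below `T`,
  -- and `16 ≤ T` makes `2M - 2 ≥ T/4` and `M ≥ T/8`. They are grouped in pairs because only two
  -- consecutive values together are bounded below.
  have hT0 : 0 < T := by linarith
  obtain ⟨M, hM⟩ : ∃ M, M = ⌊T / 4⌋₊ := ⟨_, rfl⟩
  have hM1 : (M : ℝ) ≤ T / 4 := hM ▸ Nat.floor_le (by positivity)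
  have hM2 : T / 4 < M + 1 := hM ▸ Nat.lt_floor_add_one _
  have hM3 : 1 ≤ M := hM ▸ Nat.le_floor (by norm_num; linarith)
  set w : ℝ := (T / 4) ^ p * (2 / T ^ 2) with hw
  have hw0 : 0 ≤ w := by positivity
  set g : ℕ → ℝ := fun n => ‖green hV (E + (2 / T : ℝ) * Complex.I) (s n)‖ with hgdef
  set F : ℕ → ℝ≥0∞ := fun n =>
    ENNReal.ofReal (|(s n : ℝ)| ^ p) * timeAvgProb (hamiltonian V hV) (s n) T with hF
  have hterm : ∀ y : ℕ, ENNReal.ofReal (w * g (2 * M + y) ^ 2) ≤ F (2 * M + y) := by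
    intro y
    rw [hw, mul_assoc, ENNReal.ofReal_mul (by positivity)]
    refine mul_le_mul' (ENNReal.ofReal_le_ofReal ?_) (sq_norm_green_le hV hT0 _)
    refine Real.rpow_le_rpow (by positivity) ?_ hp.le
    refine le_trans ?_ (hs' _)
    push_cast
    have : (0 : ℝ) ≤ y := Nat.cast_nonneg y
    linarith
  have hpair : ∀ x ∈ Finset.range M,
      ENNReal.ofReal (w * c) ≤ F (2 * M + 2 * x) + F (2 * M + (2 * x + 1)) := by
    intro x hx
    have hx' : (x : ℝ) + 1 ≤ M := by exact_mod_cast Finset.mem_range.1 hx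
    refine le_trans ?_ (add_le_add (hterm _) (hterm _))
    rw [← ENNReal.ofReal_add (by positivity) (by positivity), ← mul_add]
    refine ENNReal.ofReal_le_ofReal (mul_le_mul_of_nonneg_left ?_ hw0)
    exact hg (2 * M + 2 * x) (by omega) (by push_cast; linarith)
  calc ENNReal.ofReal (T / 8 * (w * c)) ≤ ENNReal.ofReal (M * (w * c)) :=
        ENNReal.ofReal_le_ofReal (mul_le_mul_of_nonneg_right (by linarith) (by positivity))
    _ = ∑ x ∈ Finset.range M, ENNReal.ofReal (w * c) := by
        rw [Finset.sum_const, Finset.card_range, nsmul_eq_mul,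
          ENNReal.ofReal_mul (Nat.cast_nonneg _), ENNReal.ofReal_natCast]
    _ ≤ ∑ x ∈ Finset.range M, (F (2 * M + 2 * x) + F (2 * M + (2 * x + 1))) :=
        Finset.sum_le_sum hpair
    _ = ∑ y ∈ Finset.range (2 * M), F (2 * M + y) :=
        sum_range_pair (fun y => F (2 * M + y)) M
    _ ≤ ∑' y : ℕ, F (2 * M + y) := ENNReal.sum_le_tsum _
    _ ≤ moment (hamiltonian V hV) p T :=
        ENNReal.tsum_comp_le_tsum_of_injective (f := fun y : ℕ => s (2 * M + y))
          (fun a b hab => by simpa using hs hab)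
          (fun n : ℤ => ENNReal.ofReal (|(n : ℝ)| ^ p) * timeAvgProb (hamiltonian V hV) n T)

/-- At distance of order `1 / T` from an energy with bounded solutions, solutions stay bounded
below up to distance `T`. -/
lemma BoundedSolutions.sq_le {V : ℤ → ℝ} {E K T c : ℝ} (hV : BoundedSolutions V E K) (hK : 0 < K)
    (hT : 0 < T) (hc : 0 ≤ c) {ψ : ℤ → ℂ}
    (hψ : ∀ i, 1 < i → ψ (i + 1) + ψ (i - 1) + V i * ψ i =
      (E + (2 / T : ℝ) * Complex.I) * ψ i)
    (h0 : c ≤ max ‖ψ 1‖ ‖ψ 2‖) (n : ℕ) (hn : 1 ≤ n) (hnT : (n : ℝ) ≤ T) :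
    (c / (2 * K * Real.exp (2 * K))) ^ 2 ≤ ‖ψ n‖ ^ 2 + ‖ψ (n + 1 : ℕ)‖ ^ 2 := by
  obtain ⟨k, rfl⟩ := Nat.exists_eq_add_of_le' hn
  have h := hV.norm_le hK.le hψ (k + 1 : ℕ) k (by push_cast; linarith)
  have e1 : ((k + 1 : ℕ) : ℤ) - k = 1 := by push_cast; ring
  have hz : ‖(E + (2 / T : ℝ) * Complex.I : ℂ) - E‖ = 2 / T := by
    rw [add_sub_cancel_left, norm_mul, Complex.norm_I, mul_one, Complex.norm_real,
      Real.norm_eq_abs, abs_of_pos (by positivity)]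
  rw [e1, hz, show (1 : ℤ) + 1 = 2 by norm_num] at h
  -- This is where the distance is limited to `T`: the accumulated perturbation `k · 2K/T` stays
  -- below `2K`.
  have hexp : (1 + 2 / T * K) ^ k ≤ Real.exp (2 * K) := by
    have i1 : 1 + 2 / T * K ≤ Real.exp (2 / T * K) := by
      rw [add_comm]; exact Real.add_one_le_exp _
    refine (pow_le_pow_left₀ (by positivity) i1 k).trans ?_
    rw [← Real.exp_nat_mul, Real.exp_le_exp]
    have hk : (k : ℝ) ≤ T := by push_cast at hnT; linarith
    calc (k : ℝ) * (2 / T * K) ≤ T * (2 / T * K) := by gcongr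
      _ = 2 * K := by field_simp
  set m := max ‖ψ (k + 1 : ℕ)‖ ‖ψ ((k + 1 : ℕ) + 1)‖ with hm
  have hm0 : 0 ≤ m := le_max_of_le_left (norm_nonneg _)
  have hle : c / (2 * K * Real.exp (2 * K)) ≤ m := by
    rw [div_le_iff₀ (by positivity)]
    refine (h0.trans h).trans ?_
    rw [mul_comm m]
    gcongr
  refine (pow_le_pow_left₀ (by positivity) hle 2).trans ?_
  rw [hm]
  push_cast
  rcases max_choice ‖ψ ((k : ℤ) + 1)‖ ‖ψ ((k : ℤ) + 1 + 1)‖ with h | h <;> rw [h] <;>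
    nlinarith [sq_nonneg ‖ψ ((k : ℤ) + 1)‖, sq_nonneg ‖ψ ((k : ℤ) + 1 + 1)‖]

/-- A power-law lower bound for the moments bounds the lower growth exponent. -/
lemma le_betaMinus {H : H2 →L[ℂ] H2} {p q C T₀ : ℝ} (hC : 0 < C)
    (h : ∀ T, T₀ ≤ T → ENNReal.ofReal (C * T ^ q) ≤ moment H p T) :
    (q : EReal) ≤ betaMinus H p := by
  -- The constant `C` contributes `log C / log T`, which vanishes in the limit.
  have hlim : Tendsto (fun T : ℝ => ((Real.log C / Real.log T + q : ℝ) : EReal)) atTop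
      (𝓝 (q : EReal)) := by
    refine (continuous_coe_real_ereal.tendsto q).comp ?_
    simpa using (Real.tendsto_log_atTop.const_div_atTop (Real.log C)).add_const q
  rw [← hlim.liminf_eq]
  refine liminf_le_liminf ?_
  filter_upwards [eventually_ge_atTop T₀, eventually_gt_atTop 1] with T hT hT1
  have hlog : 0 < Real.log T := Real.log_pos hT1
  have hT0 : 0 < T := by linarith
  have hpos : 0 < C * T ^ q := by positivity
  have e : ((Real.log C / Real.log T + q : ℝ) : EReal) =
      ENNReal.log (ENNReal.ofReal (C * T ^ q)) / ((Real.log T : ℝ) : EReal) := by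
    rw [ENNReal.log_ofReal_of_pos hpos, ← EReal.coe_div, Real.log_mul hC.ne'
      (by positivity), Real.log_rpow hT0]
    congr 1
    field_simp
  rw [e]
  exact EReal.div_le_div_right_of_nonneg (by exact_mod_cast hlog.le)
    (ENNReal.log_monotone (h T hT))

end DiscreteSchrodinger

/-! ### The lower bound for the Thue–Morse Hamiltonian -/

namespace ThueMorse

open DiscreteSchrodinger

lemma abs_potential_le (lam : ℝ) (ω : ℤ → Fin 2) (n : ℤ) : |potential lam ω n| ≤ |lam| := by
  unfold potential
  generalize ω n = e
  fin_cases e <;> simp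

lemma moment_lower_bound (lam : ℝ) {ω : ℤ → Fin 2} (hω : ω ∈ subshift) {p : ℝ} (hp : 0 < p) :
    ∃ C : ℝ, 0 < C ∧ ∀ T : ℝ, 16 ≤ T → ENNReal.ofReal (C * T ^ (p - 1)) ≤
      moment (hamiltonian (potential lam ω) (bddAbove_potential lam ω)) p T := by
  obtain ⟨E, hE⟩ : ∃ E : ℝ, E * (E - lam) = 2 := by
    refine ⟨(lam + √(lam ^ 2 + 8)) / 2, ?_⟩
    have := Real.sq_sqrt (show 0 ≤ lam ^ 2 + 8 by positivity)
    linear_combination this / 4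
  obtain ⟨L, hL⟩ : ∃ L, L = |E| + |lam| + 1 := ⟨_, rfl⟩
  have hL0 : 0 < L := by rw [hL]; positivity
  have hK : 0 < L ^ 16 := by positivity
  obtain ⟨c, hc⟩ : ∃ c, c = (1 / (L + 2) / (2 * L ^ 16 * Real.exp (2 * L ^ 16))) ^ 2 := ⟨_, rfl⟩
  have hc0 : 0 < c := by rw [hc]; positivity
  refine ⟨(1 / 4) ^ p / 4 * c, by positivity, fun T hT => ?_⟩
  have hT0 : 0 < T := by linarith
  have hV := bddAbove_potential lam ω
  have hz : 0 < (E + (2 / T : ℝ) * Complex.I : ℂ).im := by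
    simpa using hT0
  have hgreen := green_eq hV hz
  have hnorm : ‖(E + (2 / T : ℝ) * Complex.I : ℂ)‖ ≤ |E| + 1 := by
    refine (norm_add_le _ _).trans ?_
    rw [norm_mul, Complex.norm_I, mul_one, Complex.norm_real, Complex.norm_real,
      Real.norm_eq_abs, Real.norm_eq_abs, abs_of_pos (show 0 < 2 / T by positivity)]
    have : 2 / T ≤ 1 := by rw [div_le_one hT0]; linarith
    linarith
  have hgoal : ENNReal.ofReal ((1 / 4) ^ p / 4 * c * T ^ (p - 1)) =
      ENNReal.ofReal (T / 8 * ((T / 4) ^ p * (2 / T ^ 2) * c)) := by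
    congr 1
    rw [Real.rpow_sub_one hT0.ne', div_eq_mul_one_div T 4, Real.mul_rpow hT0.le (by norm_num)]
    field_simp
    norm_num
  rw [hgoal]
  -- At site `1` the equation reads `1 = G(2) + G(0) + (V(1) - z) G(1)` with `|V(1)| + |z| ≤ L`, so
  -- the three values cannot all be below `1 / (L + 2)`.
  have hcase : 1 / (L + 2) ≤ max ‖green hV (E + (2 / T : ℝ) * Complex.I) 1‖
        ‖green hV (E + (2 / T : ℝ) * Complex.I) 2‖ ∨
      1 / (L + 2) ≤ max ‖green hV (E + (2 / T : ℝ) * Complex.I) 1‖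
        ‖green hV (E + (2 / T : ℝ) * Complex.I) 0‖ := by
    by_contra! hcon
    have h1 := hgreen 1
    norm_num only [if_true] at h1
    generalize green hV (E + (2 / T : ℝ) * Complex.I) 0 = x0 at *
    generalize green hV (E + (2 / T : ℝ) * Complex.I) 1 = x1 at *
    generalize green hV (E + (2 / T : ℝ) * Complex.I) 2 = x2 at *
    generalize (E + (2 / T : ℝ) * Complex.I : ℂ) = z at *
    obtain ⟨⟨k1, k2⟩, -, k0⟩ := hcon.imp max_lt_iff.1 max_lt_iff.1
    have h2 : (1 : ℂ) = x2 + x0 + (potential lam ω 1 * x1 - z * x1) := by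
      linear_combination -h1
    have h3 : (1 : ℝ) ≤ ‖x2‖ + ‖x0‖ + (|lam| * ‖x1‖ + (|E| + 1) * ‖x1‖) := by
      calc (1 : ℝ) = ‖(1 : ℂ)‖ := by simp
        _ ≤ ‖x2‖ + ‖x0‖ + (‖(potential lam ω 1 : ℂ) * x1‖ + ‖z * x1‖) := by
          rw [h2]
          exact (norm_add_le _ _).trans (add_le_add (norm_add_le _ _) (norm_sub_le _ _))
        _ ≤ _ := by
          rw [norm_mul, norm_mul, Complex.norm_real, Real.norm_eq_abs]
          have := abs_potential_le lam ω 1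
          gcongr
    have h4 : L * ‖x1‖ ≤ L * (1 / (L + 2)) := by gcongr
    have h5 : (L + 2) * (1 / (L + 2)) = 1 := by field_simp
    have h6 : L * ‖x1‖ = |lam| * ‖x1‖ + (|E| + 1) * ‖x1‖ := by rw [hL]; ring
    linarith
  rcases hcase with h | h
  · refine le_moment hV hp hT hc0.le (E := E) (s := fun n => n) Nat.cast_injective (fun n => ?_)
      (fun n h1 h2 => ?_)
    · simp
    · rw [hc]
      refine (boundedSolutions hω hE hL.ge).sq_le hK hT0 (by positivity)
        (fun i hi => ?_) h n h1 h2
      simpa [show i ≠ 1 by omega] using hgreen i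
  -- The reflection `i ↦ 2 - i` fixes the source site `1` and exchanges `0` and `2`, so the left
  -- half-line is treated as a right one; its shift by `2` is the loss allowed in `le_moment`.
  · refine le_moment hV hp hT hc0.le (E := E) (s := fun n => 2 - n)
      (fun a b hab => by simpa using hab) (fun n => ?_) (fun n h1 h2 => ?_)
    · push_cast
      rw [abs_sub_comm]
      exact le_abs_self _
    · rw [hc]
      refine (boundedSolutions_reflect hω hE hL.ge 2).sq_le hK hT0 (by positivity)
        (ψ := fun i => green hV (E + (2 / T : ℝ) * Complex.I) (2 - i))
        (fun i hi => ?_) (by simpa using h) n h1 h2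
      have := hgreen (2 - i)
      rw [if_neg (by omega), add_zero] at this
      rw [← this, show 2 - (i + 1) = 2 - i - 1 by ring, show 2 - (i - 1) = 2 - i + 1 by ring]
      ring

end ThueMorse

theorem theorem4 (lam : ℝ) (ω : ℤ → Fin 2) (hω : ω ∈ ThueMorse.subshift) (p : ℝ) (hp : 0 < p) :
    ((p - 1 : ℝ) : EReal) ≤
      DiscreteSchrodinger.betaMinus
        (DiscreteSchrodinger.hamiltonian (ThueMorse.potential lam ω)
          (ThueMorse.bddAbove_potential lam ω)) p := by
  obtain ⟨C, hC, h⟩ := ThueMorse.moment_lower_bound lam hω hp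
  exact DiscreteSchrodinger.le_betaMinus hC h
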